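/- For a group $G$, let $\operatorname{rank}(G)$ be the smallest cardinality of a generating set of $G$. Define $\aleph\text{-}\operatorname{rank}(G)$ to be the ordinal $\alpha$ with $\operatorname{rank}(G)=\aleph_\alpha$ if $G$ is not finitely generated, and $\aleph\text{-}\operatorname{rank}(G)=-1$ if $G$ is finitely generated. For a subgroup $H\le G$, a $\mathbb{Z}G$-module $M$ is called $H$-acyclic if $H^n(H,M)=0$ for all $n\ge 1$. An abelian group $M$ is called $o(G)$-inverting if multiplication by $|H|$ is an automorphism of $M$ for every finite subgroup $H$ of $G$. For an abelian group $A$, write $AG=\mathbb{Z}G\otimes_{\mathbb{Z}}A$ for the induced $\mathbb{Z}G$-module. **Theorem.** Let $G$ be a locally finite group (every finitely generated subgroup of $G$ is finite). 1. If $M$ is a $\mathbb{Z}G$-module which is $H$-acyclic for every finite subgroup $H$ of $G$, then $H^n(G,M)=0$ for every natural number $n>\aleph\text{-}\operatorname{rank}(G)+1$. 2. The hypothesis on $M$ in (1) holds if $M=AG$ for some abelian group $A$. 3. The hypothesis on $M$ in (1) holds if $M$ is a $\mathbb{Z}G$-module that is $o(G)$-inverting. -/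

import Mathlib

open CategoryTheory
open scoped TensorProduct

universe u v w

noncomputable section

namespace HoltVanishing

/-- A group is locally finite if each of its finitely generated subgroups is finite. -/
def IsLocallyFiniteGroup (G : Type u) [Group G] : Prop :=
  ∀ H : Subgroup G, H.FG → Finite H

/-- `rank(G)`: the smallest cardinal `κ` such that `G` has a generating set of cardinality `κ`. -/
def groupRank (G : Type u) [Group G] : Cardinal.{u} :=
  sInf {κ : Cardinal.{u} | ∃ S : Set G, Subgroup.closure S = ⊤ ∧ Cardinal.mk S = κ}

open Classical in
/-- The `ℵ`-rank of `G`: the unique ordinal `α` with `rank(G) = ℵ_α` if `G` is not finitely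
generated, and `-1`, which is represented by `⊥`, if `G` is finitely generated. -/
def alephRank (G : Type u) [Group G] : WithBot Ordinal.{u} :=
  if Group.FG G then ⊥
  else ((sInf {α : Ordinal.{u} | groupRank G = Cardinal.aleph α} : Ordinal.{u}) :
    WithBot Ordinal.{u})

/-- The ordinal `ℵ-rank(G) + 1`; it is `(-1) + 1 = 0` if `G` is finitely generated. (Addition on
`WithBot` would give `⊥ + 1 = ⊥`, so the two cases are spelled out.) -/
def alephRankAddOne (G : Type u) [Group G] : Ordinal.{u} :=
  match alephRank G with
  | ⊥ => 0
  | (α : Ordinal.{u}) => α + 1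

/-- An action of `Γ` by automorphisms on an abelian group `M`, transported to a common universe,
where Mathlib's group cohomology is available. Modules over `ULift ℤ` are just abelian groups. -/
def liftRep {Γ : Type u} {M : Type v} [Group Γ] [AddCommGroup M] (ρ : Representation ℤ Γ M) :
    Rep.{max u v} (ULift.{max u v} ℤ) (ULift.{max u v} Γ) :=
  Rep.of (X := ULift.{max u v} M)
    { toFun := fun g =>
        { toFun := fun m => ULift.up (ρ g.down m.down)
          map_add' := fun x y => by ext; simp
          map_smul' := fun c x => by ext; simp }
      map_one' := by ext; simp
      map_mul' := fun g h => by ext; simp }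

/-- The cohomology group `Hⁿ(Γ, M)`, where `Γ` acts on `M` through `ρ`. -/
def groupCoh {Γ : Type u} {M : Type v} [Group Γ] [AddCommGroup M] (ρ : Representation ℤ Γ M)
    (n : ℕ) : ModuleCat.{max u v} (ULift.{max u v} ℤ) :=
  groupCohomology (liftRep ρ) n

section

variable (G : Type u) [Group G] (M : Type v) [AddCommGroup M] [Module (MonoidAlgebra ℤ G) M]

/-- The action of `G` on the `ℤG`-module `M`. -/
def moduleRep : Representation ℤ G M :=
  Representation.ofModule' M

/-- `Hⁿ(G, M)` for a `ℤG`-module `M`. -/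
def moduleCoh (n : ℕ) : ModuleCat.{max u v} (ULift.{max u v} ℤ) :=
  groupCoh (moduleRep G M) n

/-- The `ℤG`-module `M` is `H`-acyclic, for a subgroup `H` of `G`: `Hⁿ(H, M) = 0` for all `n ≥ 1`,
where `M` is viewed as a `ℤH`-module by restriction. -/
def IsSubgroupAcyclic (H : Subgroup G) : Prop :=
  ∀ n : ℕ, 1 ≤ n → Limits.IsZero (groupCoh ((moduleRep G M).comp H.subtype) n)

/-- The `ℤG`-module `M` is `H`-acyclic for every finite subgroup `H` of `G`. -/
def IsFinitelyAcyclic : Prop :=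
  ∀ H : Subgroup G, Finite H → IsSubgroupAcyclic G M H

end

/-- The abelian group `A` is `o(G)`-inverting: for every finite subgroup `H` of `G`, multiplication
by `|H|` is an automorphism of `A`. -/
def IsOrderInverting (G : Type u) [Group G] (A : Type v) [AddCommGroup A] : Prop :=
  ∀ H : Subgroup G, Finite H → Function.Bijective (fun a : A => Nat.card H • a)

end HoltVanishing

end

/-!
Everything is done with inhomogeneous cochains. `ExactOn ρ H n` says that every cocycle of degree
`n + 1` on the subgroup `H` is a coboundary on `H`, which is `Hⁿ⁺¹(H, M) = 0`
(`isZero_groupCoh_comp_iff`).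

*The main assertion.* Let `H` be a subgroup of infinite cardinality `κ`, and list its elements
along the initial ordinal of `κ`. The subgroups generated by the initial segments form a continuous
chain with union `H`, and they are all of cardinality less than `κ`, since finitely many elements
generate a finite group. If these subgroups have no cohomology in degrees `n + 1` and `n + 2`, then
`Hⁿ⁺²(H, M) = 0`: for a cocycle `c` on `H`, primitives on the members of the chain are chosen by
transfinite recursion, each extending the previous ones. At a limit step there is nothing to do
except to take the union. At a successor step any primitive of `c` over the larger subgroup
differs over the smaller one from the primitive already chosen by a cocycle of degree `n + 1`, which
is a coboundary and can therefore be corrected (`exists_primitive_extending`,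
`ExactOn.closure_range`). By induction on `k`, starting from the finite subgroups, subgroups of
cardinality less than `ℵₖ` have no cohomology in degrees greater than `k`
(`ExactOn.of_mk_lt_aleph`). A group with `ℵ`-rank `k` has cardinality at most `ℵₖ`, hence less than
`ℵₖ₊₁`; if the `ℵ`-rank is at least `ω`, no natural number exceeds it.

*The examples.* If `∑ h ∈ H, h θ h⁻¹ = 1` for an additive endomorphism `θ` of `M`, an explicit
contracting homotopy shows that `M` is `H`-acyclic (`ExactOn.of_sum_conj_eq`). For an `o(G)`-inverting
module `θ` is division by `|H|`; for `ℤG ⊗ A` it is the projection onto `ℤT ⊗ A`, where `T` is a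
transversal of the cosets `Hg`.
-/

namespace HoltVanishing

/-! ### Inhomogeneous cochains and vanishing on a subgroup -/

section Cochains

section Lift

variable {G : Type u} {M : Type v}

/-- An unlifted cochain, viewed as a cochain with values in `liftRep ρ`. -/
def liftCochain (n : ℕ) (f : (Fin n → G) → M) :
    (Fin n → ULift.{max u v} G) → ULift.{max u v} M :=
  fun g => ULift.up (f fun i => (g i).down)

lemma liftCochain_injective (n : ℕ) :
    Function.Injective (liftCochain (G := G) (M := M) n) := fun f f' h => by
  funext g
  simpa [liftCochain] using congrFun h fun i => ULift.up (g i)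

lemma liftCochain_surjective (n : ℕ) :
    Function.Surjective (liftCochain (G := G) (M := M) n) := fun f =>
  ⟨fun g => (f fun i => ULift.up (g i)).down, rfl⟩

end Lift

variable {Γ : Type u} {G : Type u} {M : Type v} [Group Γ] [Group G] [AddCommGroup M]

/-- The differential of the complex of inhomogeneous cochains `(Fin n → G) → M`, without any
universe lifting. -/
def cochainD (ρ : Representation ℤ G M) (n : ℕ) :
    ((Fin n → G) → M) →+ ((Fin (n + 1) → G) → M) where
  toFun f g := ρ (g 0) (f fun i => g i.succ) +
    ∑ j : Fin (n + 1), (-1 : ℤ) ^ ((j : ℕ) + 1) • f (Fin.contractNth j (· * ·) g)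
  map_zero' := by ext; simp
  map_add' f f' := by ext; simp [Finset.sum_add_distrib, add_add_add_comm]

lemma cochainD_apply (ρ : Representation ℤ G M) (n : ℕ) (f : (Fin n → G) → M)
    (g : Fin (n + 1) → G) :
    cochainD ρ n f g = ρ (g 0) (f fun i => g i.succ) +
      ∑ j : Fin (n + 1), (-1 : ℤ) ^ ((j : ℕ) + 1) • f (Fin.contractNth j (· * ·) g) := rfl

/-- `Hⁿ⁺¹(H, M) = 0` in terms of cochains. Cochains on `H` are represented by cochains on `G`, of
which only the values at tuples in `H` matter; this avoids restriction and extension maps. -/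
def ExactOn (ρ : Representation ℤ G M) (H : Subgroup G) (n : ℕ) : Prop :=
  ∀ c : (Fin (n + 1) → G) → M, (∀ g, (∀ i, g i ∈ H) → cochainD ρ (n + 1) c g = 0) →
    ∃ b : (Fin n → G) → M, ∀ g, (∀ i, g i ∈ H) → cochainD ρ n b g = c g

lemma contractNth_mem {H : Subgroup G} {n : ℕ} (j : Fin (n + 1)) {g : Fin (n + 1) → G}
    (hg : ∀ i, g i ∈ H) (i : Fin n) : Fin.contractNth j (· * ·) g i ∈ H := by
  unfold Fin.contractNth
  split_ifs
  exacts [hg _, H.mul_mem (hg _) (hg _), hg _]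

lemma cochainD_congr (ρ : Representation ℤ G M) {H : Subgroup G} {n : ℕ}
    {f f' : (Fin n → G) → M} (h : ∀ g, (∀ i, g i ∈ H) → f g = f' g)
    (g : Fin (n + 1) → G) (hg : ∀ i, g i ∈ H) : cochainD ρ n f g = cochainD ρ n f' g := by
  rw [cochainD_apply, cochainD_apply, h _ fun i => hg _]
  congr 1
  exact Finset.sum_congr rfl fun j _ => by rw [h _ (contractNth_mem j hg)]

/-- The differential commutes with pulling cochains back along a group homomorphism. -/
lemma cochainD_comp (ρ : Representation ℤ G M) (φ : Γ →* G) {n : ℕ} (f : (Fin n → G) → M)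
    (g : Fin (n + 1) → Γ) :
    cochainD (ρ.comp φ) n (fun x => f (φ ∘ x)) g = cochainD ρ n f (φ ∘ g) := by
  simp only [cochainD_apply, Fin.comp_contractNth (· * ·) (· * ·) (map_mul φ)]
  rfl

lemma d_liftCochain (ρ : Representation ℤ G M) (n : ℕ) (f : (Fin n → G) → M) :
    inhomogeneousCochains.d (liftRep ρ) n (liftCochain n f) =
      liftCochain (n + 1) (cochainD ρ n f) := by
  funext g
  apply ULift.down_injective
  have key (j : Fin (n + 1)) : (fun i => (Fin.contractNth j (· * ·) g i).down) =
      Fin.contractNth j (· * ·) fun i => (g i).down :=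
    Fin.comp_contractNth (f := ULift.down) (· * ·) (· * ·) (fun _ _ => rfl) j g
  have hsum (s : Finset (Fin (n + 1))) (F : Fin (n + 1) → ULift.{max u v} M) :
      (∑ j ∈ s, F j).down = ∑ j ∈ s, (F j).down :=
    map_sum (AddEquiv.ulift (α := M)).toAddMonoidHom F s
  refine (congrArg ULift.down (inhomogeneousCochains.d_hom_apply
    (liftRep ρ) n (liftCochain n f) g)).trans ?_
  refine congrArg₂ (· + ·) rfl ((hsum _ _).trans (Finset.sum_congr rfl fun j _ => ?_))
  unfold liftCochain
  rw [← key]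
  rfl

lemma cochainD_cochainD (ρ : Representation ℤ G M) (n : ℕ) (f : (Fin n → G) → M) :
    cochainD ρ (n + 1) (cochainD ρ n f) = 0 := by
  apply liftCochain_injective
  rw [← d_liftCochain, ← d_liftCochain]
  exact congrArg (fun φ => φ.hom (liftCochain n f))
    (groupCohomology.inhomogeneousCochains.d_comp_d (A := liftRep ρ) n)

lemma isZero_groupCoh_succ_iff (ρ : Representation ℤ G M) (n : ℕ) :
    Limits.IsZero (groupCoh ρ (n + 1)) ↔
      ∀ c, cochainD ρ (n + 1) c = 0 → ∃ b, cochainD ρ n b = c := by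
  unfold groupCoh groupCohomology
  rw [← HomologicalComplex.exactAt_iff_isZero_homology,
    HomologicalComplex.exactAt_iff' _ n (n + 1) (n + 2) (by simp) (by simp),
    ShortComplex.moduleCat_exact_iff]
  have hd (m : ℕ) (f : (Fin m → G) → M) :
      ((groupCohomology.inhomogeneousCochains (liftRep ρ)).d m (m + 1)).hom (liftCochain m f) =
        liftCochain (m + 1) (cochainD ρ m f) :=
    (congrArg (fun φ => φ.hom (liftCochain m f))
      (groupCohomology.inhomogeneousCochains.d_def (A := liftRep ρ) m)).trans (d_liftCochain ρ m f)
  constructor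
  · intro h c hc
    obtain ⟨b, hb⟩ := h (liftCochain (n + 1) c)
      ((hd (n + 1) c).trans (congrArg (liftCochain (n + 2)) hc))
    obtain ⟨b, rfl⟩ := liftCochain_surjective n b
    exact ⟨b, liftCochain_injective _ ((hd n b).symm.trans hb)⟩
  · intro h c hc
    obtain ⟨c, rfl⟩ := liftCochain_surjective (n + 1) c
    obtain ⟨b, rfl⟩ := h c (liftCochain_injective _ ((hd (n + 1) c).symm.trans hc))
    exact ⟨liftCochain n b, hd n b⟩

theorem isZero_groupCoh_comp_iff (ρ : Representation ℤ G M) (φ : Γ →* G)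
    (hφ : Function.Injective φ) (n : ℕ) :
    Limits.IsZero (groupCoh (ρ.comp φ) (n + 1)) ↔ ExactOn ρ φ.range n := by
  rw [isZero_groupCoh_succ_iff]
  have lift {m : ℕ} (g : Fin m → G) (hg : ∀ i, g i ∈ φ.range) : ∃ x : Fin m → Γ, φ ∘ x = g := by
    choose x hx using hg
    exact ⟨x, funext hx⟩
  have ext {m : ℕ} (f : (Fin m → Γ) → M) : ∃ f' : (Fin m → G) → M, f = fun x => f' (φ ∘ x) :=
    ⟨Function.extend (φ ∘ ·) f 0, funext fun x => (hφ.comp_left.extend_apply f 0 x).symm⟩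
  constructor
  · intro h c hc
    obtain ⟨b, hb⟩ := h (fun x => c (φ ∘ x)) <| funext fun g => by
      rw [cochainD_comp, hc (φ ∘ g) fun i => ⟨g i, rfl⟩]; rfl
    obtain ⟨b, rfl⟩ := ext b
    refine ⟨b, fun g hg => ?_⟩
    obtain ⟨x, rfl⟩ := lift g hg
    rw [← cochainD_comp, hb]
  · intro h c hc
    obtain ⟨c, rfl⟩ := ext c
    obtain ⟨b, hb⟩ := h c fun g hg => by
      obtain ⟨x, rfl⟩ := lift g hg
      rw [← cochainD_comp, hc]; rfl
    exact ⟨fun x => b (φ ∘ x), funext fun g => by rw [cochainD_comp, hb (φ ∘ g) fun i => ⟨g i, rfl⟩]⟩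

end Cochains

/-! ### Acyclicity from a resolution of the identity into conjugates -/

section Trace

variable {G : Type u} {M : Type v} [Group G] [AddCommGroup M]

lemma partialProd_contractNth_last {n : ℕ} (j : Fin (n + 1)) (g : Fin (n + 1) → G) :
    Fin.partialProd (Fin.contractNth j (· * ·) g) (Fin.last n) =
      if j = Fin.last n then Fin.partialProd g (Fin.last n).castSucc
      else Fin.partialProd g (Fin.last (n + 1)) := by
  rw [Fin.partialProd_contractNth, Function.comp_apply]
  split_ifs with h
  · subst h
    rw [Fin.succ_last, Fin.succAbove_last]
  · rw [Fin.succAbove_of_le_castSucc, Fin.succ_last]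
    rw [Fin.le_def]
    have := Fin.val_lt_last h
    simp only [Fin.val_succ, Fin.val_castSucc, Fin.val_last]
    omega

lemma contractNth_castSucc_snoc {n : ℕ} (j : Fin (n + 1)) (hj : j ≠ Fin.last n)
    (g : Fin (n + 1) → G) (k : G) :
    Fin.contractNth j.castSucc (· * ·) (Fin.snoc g k : Fin (n + 2) → G) =
      Fin.snoc (Fin.contractNth j (· * ·) g : Fin n → G) k := by
  have hj' := Fin.val_lt_last hj
  funext i
  induction i using Fin.lastCases with
  | last =>
    rw [Fin.contractNth_apply_of_gt _ _ _ _ (by simpa using hj'), Fin.snoc_last, Fin.succ_last,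
      Fin.snoc_last]
  | cast i =>
    rw [Fin.snoc_castSucc, Fin.contractNth, Fin.contractNth]
    simp only [Fin.val_castSucc, Fin.snoc_castSucc, ← Fin.castSucc_succ]

lemma contractNth_last_castSucc_snoc {n : ℕ} (g : Fin (n + 1) → G) (k : G) :
    Fin.contractNth (Fin.last n).castSucc (· * ·) (Fin.snoc g k : Fin (n + 2) → G) =
      Fin.snoc (fun i => g i.castSucc : Fin n → G) (g (Fin.last n) * k) := by
  funext i
  induction i using Fin.lastCases with
  | last =>
    rw [Fin.contractNth_apply_of_eq _ _ _ _ (by simp), Fin.snoc_last, Fin.succ_last,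
      Fin.snoc_last, Fin.snoc_castSucc]
  | cast i =>
    rw [Fin.contractNth_apply_of_lt _ _ _ _ (by simp), Fin.snoc_castSucc, Fin.snoc_castSucc]

lemma contractNth_last_snoc {n : ℕ} (g : Fin (n + 1) → G) (k : G) :
    Fin.contractNth (Fin.last (n + 1)) (· * ·) (Fin.snoc g k : Fin (n + 2) → G) = g := by
  funext i
  rw [Fin.contractNth_apply_of_lt _ _ _ _ i.isLt, Fin.snoc_castSucc]

lemma contractNth_last {n : ℕ} (g : Fin (n + 1) → G) :
    Fin.contractNth (Fin.last n) (· * ·) g = fun i => g i.castSucc := by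
  funext i
  rw [Fin.contractNth_apply_of_lt _ _ _ _ (by simp)]

/-- If the identity of `M` is the sum of the `H`-conjugates of an additive map `θ`, i.e. `M` is
relatively projective over the trivial subgroup, then `M` is `H`-acyclic. In homogeneous coordinates the
contracting homotopy is `B(x₀, …, xₙ) = ∑ h, (h θ h⁻¹) F(x₀, …, xₙ, h)`. -/
theorem ExactOn.of_sum_conj_eq (ρ : Representation ℤ G M) (H : Subgroup G) [Fintype H] (θ : M →+ M)
    (hθ : ∀ m, ∑ h : H, ρ h (θ (ρ (h : G)⁻¹ m)) = m) (n : ℕ) : ExactOn ρ H n := by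
  intro c hc
  let A : G → M →+ M := fun x => (ρ x).toAddMonoidHom.comp (θ.comp (ρ x⁻¹).toAddMonoidHom)
  have hA (x : G) (m : M) : A x m = ρ x (θ (ρ x⁻¹ m)) := rfl
  have hA_mul (x y : G) (m : M) : A (x * y) (ρ x m) = ρ x (A y m) := by
    simp only [hA, map_mul, mul_inv_rev, Module.End.mul_apply]
    rw [← Module.End.mul_apply (ρ x⁻¹), ← map_mul, inv_mul_cancel, map_one, Module.End.one_apply]
  have hsum (x : G) (hx : x ∈ H) (m : M) : ∑ k : H, A (x * k) m = m := by
    refine Eq.trans ?_ (hθ m)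
    exact Fintype.sum_equiv (Equiv.mulLeft (⟨x, hx⟩ : H)) _ _ fun k => rfl
  let s : (Fin n → G) → M := fun g =>
    ∑ k : H, A (Fin.partialProd g (Fin.last n) * k) (c (Fin.snoc g (k : G)))
  refine ⟨fun g => (-1 : ℤ) ^ (n + 1) • s g, fun g hg => ?_⟩
  have hP (i : Fin (n + 2)) : Fin.partialProd g i ∈ H := by
    induction i using Fin.induction with
    | zero => simp
    | succ i ih => rw [Fin.partialProd_succ]; exact H.mul_mem ih (hg i)
  set P := Fin.partialProd g (Fin.last (n + 1)) with hPdef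
  -- Apply `A (P * k)` to the cocycle condition at `(g, k)` and sum over all `k` in `H`.
  have key (k : H) := hc (Fin.snoc g (k : G)) fun i => by
    induction i using Fin.lastCases with
    | last => simp
    | cast i => simpa using hg i
  simp only [cochainD_apply, Fin.sum_univ_castSucc (n := n + 1), contractNth_last_snoc] at key
  have total : ∑ k : H, A (P * k) (0 : M) = 0 := by simp
  rw [← Finset.sum_congr rfl fun (k : H) _ => congrArg (A (P * (k : G))) (key k)] at total
  simp only [map_add, Finset.sum_add_distrib, map_zsmul, map_sum] at total
  rw [← Finset.smul_sum, hsum P (hP _)] at total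
  have first : ∑ k : H, A (P * k) (ρ ((Fin.snoc g (k : G) : Fin (n + 2) → G) 0)
      (c fun i => (Fin.snoc g (k : G) : Fin (n + 2) → G) i.succ)) =
        ρ (g 0) (s fun i => g i.succ) := by
    rw [map_sum]
    refine Finset.sum_congr rfl fun k _ => ?_
    have e1 : (Fin.snoc g (k : G) : Fin (n + 2) → G) 0 = g 0 := by
      rw [← Fin.castSucc_zero, Fin.snoc_castSucc]
    have e2 : (fun i => (Fin.snoc g (k : G) : Fin (n + 2) → G) i.succ) =
        Fin.snoc (fun i => g i.succ) (k : G) := by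
      funext i
      induction i using Fin.lastCases with
      | last => rw [Fin.succ_last, Fin.snoc_last, Fin.snoc_last]
      | cast i => rw [← Fin.castSucc_succ, Fin.snoc_castSucc, Fin.snoc_castSucc]
    rw [e1, e2, hPdef, ← Fin.succ_last, Fin.partialProd_succ', mul_assoc, hA_mul]
    rfl
  have middle (j : Fin (n + 1)) :
      ∑ k : H, A (P * k) (c (Fin.contractNth j.castSucc (· * ·) (Fin.snoc g (k : G)))) =
        s (Fin.contractNth j (· * ·) g) := by
    by_cases hj : j = Fin.last n
    · subst hj
      have hg' := hg (Fin.last n)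
      simp only [contractNth_last_castSucc_snoc, contractNth_last]
      refine Fintype.sum_equiv (Equiv.mulLeft (⟨g (Fin.last n), hg'⟩ : H)) _ _ fun k => ?_
      have : Fin.partialProd (fun i : Fin n => g i.castSucc) (Fin.last n) =
          Fin.partialProd g (Fin.last n).castSucc := Fin.partialProd_init (f := g) (Fin.last n)
      rw [this, hPdef, ← Fin.succ_last, Fin.partialProd_succ, mul_assoc]
      rfl
    · simp only [contractNth_castSucc_snoc j hj, s, partialProd_contractNth_last, if_neg hj]
      rfl
  rw [first, Finset.sum_comm] at total
  simp only [← Finset.smul_sum, middle, Fin.val_castSucc, Fin.val_last] at total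
  have hsm : (fun g => (-1 : ℤ) ^ (n + 1) • s g) = (-1 : ℤ) ^ (n + 1) • s := rfl
  rw [← add_assoc, pow_succ _ (n + 1), mul_neg_one, neg_smul, add_neg_eq_zero] at total
  rw [hsm, map_zsmul, Pi.smul_apply, cochainD_apply, total, smul_smul, ← mul_pow]
  simp

end Trace

/-! ### Gluing primitives along a chain of subgroups -/

section Gluing

variable {G : Type u} {M : Type v} [Group G] [AddCommGroup M]

/-- A tuple in the subgroup generated by the union of a chain of sets lies in the subgroup
generated by one of them. -/
lemma exists_forall_mem_closure_image {I ι : Type*} [Nonempty ι] (x : I → G) (L : ι → Set I)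
    (hL : Directed (· ⊆ ·) L) {m : ℕ} (g : Fin m → G)
    (hg : ∀ i, g i ∈ Subgroup.closure (x '' ⋃ p, L p)) :
    ∃ p, ∀ i, g i ∈ Subgroup.closure (x '' L p) := by
  have hdir : Directed (· ≤ ·) fun p => Subgroup.closure (x '' L p) :=
    hL.mono_comp (r := (· ⊆ ·)) (rb := (· ≤ ·)) (g := fun s : Set I => Subgroup.closure (x '' s))
      fun _ _ h => Subgroup.closure_mono (Set.image_mono h)
  simp only [Set.image_iUnion, Subgroup.closure_iUnion, Subgroup.mem_iSup_of_directed hdir] at hg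
  choose p hp using hg
  obtain ⟨z, hz⟩ := hdir.finite_le p
  exact ⟨z, fun i => hz i (hp i)⟩

/-- Extension step of the transfinite construction: a primitive of the cocycle `c` over `K` can be
changed to one that extends a given primitive over a subgroup `K'`. The difference of the two
is a cocycle on `K'`, hence a coboundary there, and any extension of its primitive to `K` serves
as a correction. -/
lemma exists_primitive_extending (ρ : Representation ℤ G M) {K' K : Subgroup G} (hK : K' ≤ K)
    {n : ℕ} (h' : ExactOn ρ K' n) (h : ExactOn ρ K (n + 1)) {c : (Fin (n + 2) → G) → M}
    (hc : ∀ g, (∀ i, g i ∈ K) → cochainD ρ (n + 2) c g = 0) {b : (Fin (n + 1) → G) → M}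
    (hb : ∀ g, (∀ i, g i ∈ K') → cochainD ρ (n + 1) b g = c g) :
    ∃ b' : (Fin (n + 1) → G) → M, (∀ g, (∀ i, g i ∈ K) → cochainD ρ (n + 1) b' g = c g) ∧
      ∀ g, (∀ i, g i ∈ K') → b' g = b g := by
  obtain ⟨a, ha⟩ := h c hc
  obtain ⟨e, he⟩ := h' (a - b) fun g hg => by
    rw [map_sub, Pi.sub_apply, ha g fun i => hK (hg i), hb g hg, sub_self]
  refine ⟨a - cochainD ρ n e, fun g hg => ?_, fun g hg => ?_⟩
  · rw [map_sub, cochainD_cochainD, sub_zero, ha g hg]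
  · rw [Pi.sub_apply, he g hg, Pi.sub_apply, sub_sub_cancel]

/-- Vanishing along a well-ordered generating family: the subgroups generated by the initial
segments form a continuous chain, along which primitives of a cocycle can be chosen compatibly. -/
theorem ExactOn.closure_range (ρ : Representation ℤ G M) {I : Type*} [LinearOrder I]
    [WellFoundedLT I] (x : I → G) (n : ℕ) (hbot : ExactOn ρ ⊥ (n + 1))
    (hlt : ∀ i, ExactOn ρ (Subgroup.closure (x '' Set.Iio i)) n)
    (hle : ∀ i, ExactOn ρ (Subgroup.closure (x '' Set.Iic i)) (n + 1)) :
    ExactOn ρ (Subgroup.closure (Set.range x)) (n + 1) := by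
  classical
  intro c hc
  let K : Set I → Subgroup G := fun L => Subgroup.closure (x '' L)
  have hKmono {L L' : Set I} (h : L ⊆ L') : K L ≤ K L' :=
    Subgroup.closure_mono (Set.image_mono h)
  have hKc (L : Set I) (g) (hg : ∀ i, g i ∈ K L) : cochainD ρ (n + 2) c g = 0 :=
    hc g fun i => Subgroup.closure_mono (Set.image_subset_range x L) (hg i)
  -- Partial primitives, defined over an initial segment of the generators.
  let P := {p : Set I × ((Fin (n + 1) → G) → M) // IsLowerSet p.1 ∧
    ∀ g, (∀ i, g i ∈ K p.1) → cochainD ρ (n + 1) p.2 g = c g}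
  let r : P → P → Prop := fun p q => p.1.1 ⊆ q.1.1 ∧ ∀ g, (∀ i, g i ∈ K p.1.1) → q.1.2 g = p.1.2 g
  have : Nonempty P := by
    obtain ⟨b, hb⟩ := hbot c fun g hg => hKc ∅ g fun i => by
      rw [Subgroup.mem_bot.1 (hg i)]; exact one_mem _
    exact ⟨⟨(∅, b), isLowerSet_empty, fun g hg => hb g fun i => by simpa [K] using hg i⟩⟩
  obtain ⟨⟨⟨L, b⟩, hL, hb⟩, hmax⟩ : ∃ m : P, ∀ a, r m a → r a m := by
    refine exists_maximal_of_nonempty_chains_bounded (fun C hC hne => ?_) fun {p q s} h₁ h₂ =>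
      ⟨h₁.1.trans h₂.1, fun g hg => (h₂.2 g fun i => hKmono h₁.1 (hg i)).trans (h₁.2 g hg)⟩
    have := hne.to_subtype
    have hdir : Directed (· ⊆ ·) fun p : C => p.1.1.1 := fun p q => by
      rcases eq_or_ne p.1 q.1 with h | h
      · exact ⟨p, subset_rfl, by rw [Subtype.ext h]⟩
      · rcases hC p.2 q.2 h with h | h
        exacts [⟨q, h.1, subset_rfl⟩, ⟨p, subset_rfl, h.1⟩]
    let b : (Fin (n + 1) → G) → M := fun g =>
      if h : ∃ p : C, ∀ i, g i ∈ K p.1.1.1 then h.choose.1.1.2 g else 0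
    have hbC (p : C) (g) (hg : ∀ i, g i ∈ K p.1.1.1) : b g = p.1.1.2 g := by
      have hex : ∃ p : C, ∀ i, g i ∈ K p.1.1.1 := ⟨p, hg⟩
      have hq := hex.choose_spec
      simp only [b, dif_pos hex]
      generalize hex.choose = q at hq ⊢
      rcases eq_or_ne p.1 q.1 with h | h
      · rw [h]
      · rcases hC p.2 q.2 h with h | h
        exacts [h.2 g hg, (h.2 g hq).symm]
    refine ⟨⟨(⋃ p : C, p.1.1.1, b), isLowerSet_iUnion fun p => p.1.2.1, fun g hg => ?_⟩,
      fun p hp => ⟨Set.subset_iUnion (fun p : C => p.1.1.1) ⟨p, hp⟩, fun g hg => hbC ⟨p, hp⟩ g hg⟩⟩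
    obtain ⟨p, hp⟩ := exists_forall_mem_closure_image x _ hdir g hg
    rw [cochainD_congr ρ (H := K p.1.1.1) (hbC p) g hp, p.1.2.2 g hp]
  by_cases htop : L = Set.univ
  · subst htop
    exact ⟨b, fun g hg => hb g fun i => by simpa [K] using hg i⟩
  exfalso
  -- Otherwise `L` is a proper initial segment `Iio i`, and the primitive extends to `Iic i`.
  obtain ⟨i, hi, hmin⟩ := WellFounded.has_min (r := ((· < ·) : I → I → Prop)) wellFounded_lt Lᶜ
    (Set.nonempty_compl.2 htop)
  have hLi : L = Set.Iio i := by
    ext j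
    refine ⟨fun hj => ?_, fun hj => ?_⟩
    · exact lt_of_not_ge fun hij => hi (hL hij hj)
    · by_contra hjL
      exact hmin j hjL hj
  subst hLi
  obtain ⟨b', hb', hext⟩ := exists_primitive_extending ρ (hKmono Set.Iio_subset_Iic_self) (hlt i)
    (hle i) (hKc _) hb
  exact hi ((hmax ⟨(Set.Iic i, b'), isLowerSet_Iic i, hb'⟩ ⟨Set.Iio_subset_Iic_self, hext⟩).1
    Set.self_mem_Iic)

end Gluing

/-! ### Induction on the cardinality -/

section Cardinality

variable {G : Type u} {M : Type v} [Group G] [AddCommGroup M]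

open Cardinal

lemma mk_closure_le_max (S : Set G) : #(Subgroup.closure S) ≤ max #S ℵ₀ := by
  rw [FreeGroup.closure_eq_range]
  refine (mk_le_of_surjective (MonoidHom.rangeRestrict_surjective _)).trans ?_
  rcases isEmpty_or_nonempty S with h | h
  · exact le_max_of_le_right (by rw [mk_le_aleph0_iff]; infer_instance)
  · rw [mk_freeGroup]

lemma IsLocallyFiniteGroup.mk_closure_lt (hG : IsLocallyFiniteGroup G) {S : Set G}
    {κ : Cardinal.{u}} (hκ : ℵ₀ ≤ κ) (hS : #S < κ) : #(Subgroup.closure S) < κ := by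
  rcases S.finite_or_infinite with hfin | hinf
  · have := hG (Subgroup.closure S) ⟨hfin.toFinset, by simp⟩
    exact (lt_aleph0_of_finite _).trans_le hκ
  · have := hinf.to_subtype
    exact (mk_closure_le_max S).trans_lt (by rwa [max_eq_left (aleph0_le_mk S)])

/-- Vanishing passes from the subgroups of cardinality less than `#H` to `H`, at the cost of one
degree: `H` is the union of a continuous chain of such subgroups. -/
theorem ExactOn.of_smaller (hG : IsLocallyFiniteGroup G) (ρ : Representation ℤ G M)
    (H : Subgroup G) (hH : ℵ₀ ≤ #H) (n : ℕ)
    (h : ∀ K : Subgroup G, #K < #H → ExactOn ρ K n ∧ ExactOn ρ K (n + 1)) :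
    ExactOn ρ H (n + 1) := by
  obtain ⟨_, _, hord⟩ := exists_ord_eq_type_lt H
  have hIio (i : H) : #(Set.Iio i) < #H := mk_Iio_lt i hord
  have hIic (i : H) : #(Set.Iic i) < #H := by
    rw [← Set.Iio_insert]
    exact (mk_insert_le).trans_lt (add_lt_of_lt hH (hIio i) (one_lt_aleph0.trans_le hH))
  have key := ExactOn.closure_range ρ (Subtype.val : H → G) n
    (h ⊥ ((lt_aleph0_of_finite _).trans_le hH)).2
    (fun i => (h _ (hG.mk_closure_lt hH (mk_image_le.trans_lt (hIio i)))).1)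
    (fun i => (h _ (hG.mk_closure_lt hH (mk_image_le.trans_lt (hIic i)))).2)
  rwa [Subtype.range_coe, Subgroup.closure_eq] at key

/-- Subgroups of cardinality less than `ℵₖ` have no cohomology in degrees greater than `k`. -/
theorem ExactOn.of_mk_lt_aleph (hG : IsLocallyFiniteGroup G) (ρ : Representation ℤ G M)
    (hfin : ∀ H : Subgroup G, Finite H → ∀ n, ExactOn ρ H n) (k : ℕ) :
    ∀ H : Subgroup G, #H < aleph k → ∀ n, k ≤ n → ExactOn ρ H n := by
  induction k with
  | zero =>
    intro H hH n _
    rw [Nat.cast_zero, aleph_zero, lt_aleph0_iff_finite] at hH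
    exact hfin H hH n
  | succ k ih =>
    intro H hH n hn
    rw [Nat.cast_succ, ← succ_aleph, Order.lt_succ_iff] at hH
    obtain ⟨m, rfl⟩ : ∃ m, n = m + 1 := ⟨n - 1, by omega⟩
    rcases hH.lt_or_eq with hlt | heq
    · exact ih H hlt _ (by omega)
    · refine ExactOn.of_smaller hG ρ H (by rw [heq]; exact aleph0_le_aleph _) m fun K hK => ?_
      rw [heq] at hK
      exact ⟨ih K hK m (by omega), ih K hK (m + 1) (by omega)⟩

lemma exists_closure_eq_top_mk_eq_groupRank (G : Type u) [Group G] :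
    ∃ S : Set G, Subgroup.closure S = ⊤ ∧ #S = groupRank G :=
  csInf_mem (s := {κ : Cardinal.{u} | ∃ S : Set G, Subgroup.closure S = ⊤ ∧ #S = κ})
    ⟨_, Set.univ, Subgroup.closure_univ, rfl⟩

lemma alephRankAddOne_eq_zero (h : Group.FG G) : alephRankAddOne G = 0 := by
  simp [alephRankAddOne, alephRank, h]

lemma exists_alephRankAddOne_eq (h : ¬ Group.FG G) :
    ∃ α : Ordinal.{u}, alephRankAddOne G = α + 1 ∧ groupRank G = aleph α := by
  obtain ⟨S, hS, hcard⟩ := exists_closure_eq_top_mk_eq_groupRank G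
  have hinf : ℵ₀ ≤ groupRank G := by
    by_contra! hlt
    rw [← hcard, lt_aleph0_iff_set_finite] at hlt
    exact h ⟨hlt.toFinset, by simpa using hS⟩
  obtain ⟨α, hα⟩ := mem_range_aleph_iff.2 hinf
  refine ⟨sInf {α : Ordinal.{u} | groupRank G = aleph α}, by simp [alephRankAddOne, alephRank, h],
    csInf_mem (s := {α : Ordinal.{u} | groupRank G = aleph α}) ⟨α, hα.symm⟩⟩

lemma mk_top_le_max_groupRank (G : Type u) [Group G] :
    #(⊤ : Subgroup G) ≤ max (groupRank G) ℵ₀ := by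
  obtain ⟨S, hS, hcard⟩ := exists_closure_eq_top_mk_eq_groupRank G
  rw [← hcard, ← hS]
  exact mk_closure_le_max S

theorem ExactOn.top_of_alephRankAddOne_lt (hG : IsLocallyFiniteGroup G) (ρ : Representation ℤ G M)
    (hfin : ∀ H : Subgroup G, Finite H → ∀ n, ExactOn ρ H n) (n : ℕ)
    (hn : alephRankAddOne G < ((n + 1 : ℕ) : Ordinal.{u})) : ExactOn ρ ⊤ n := by
  by_cases hfg : Group.FG G
  · exact hfin ⊤ (hG ⊤ hfg.out) n
  · obtain ⟨α, hα, hrank⟩ := exists_alephRankAddOne_eq hfg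
    rw [hα] at hn
    obtain ⟨k, rfl⟩ : ∃ k : ℕ, α = k :=
      Ordinal.lt_omega0.1 <| (Order.lt_add_one_iff.2 le_rfl).trans <|
        hn.trans (Ordinal.natCast_lt_omega0 _)
    refine ExactOn.of_mk_lt_aleph hG ρ hfin (k + 1) ⊤ ?_ n ?_
    · rw [Nat.cast_succ, ← succ_aleph, Order.lt_succ_iff]
      refine (mk_top_le_max_groupRank G).trans ?_
      rw [hrank, max_eq_left (aleph0_le_aleph _)]
    · exact Nat.lt_succ_iff.1 (by exact_mod_cast hn)

end Cardinality

/-! ### Induced and order-inverting modules -/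

section Modules

variable {G : Type u} [Group G]

section

variable {M : Type v} [AddCommGroup M] [Module (MonoidAlgebra ℤ G) M]

lemma moduleRep_apply (g : G) (m : M) :
    moduleRep G M g m = (MonoidAlgebra.single g 1 : MonoidAlgebra ℤ G) • m := rfl

lemma isFinitelyAcyclic_iff :
    IsFinitelyAcyclic G M ↔ ∀ H : Subgroup G, Finite H → ∀ n, ExactOn (moduleRep G M) H n := by
  have key (H : Subgroup G) (n : ℕ) :=
    isZero_groupCoh_comp_iff (moduleRep G M) H.subtype H.subtype_injective n
  simp only [Subgroup.range_subtype] at key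
  refine forall₂_congr fun H _ => ⟨fun h n => (key H n).1 (h (n + 1) (by omega)), fun h n hn => ?_⟩
  obtain ⟨n, rfl⟩ : ∃ m, n = m + 1 := ⟨n - 1, by omega⟩
  exact (key H n).2 (h n)

lemma isZero_moduleCoh_succ_iff (n : ℕ) :
    Limits.IsZero (moduleCoh G M (n + 1)) ↔ ExactOn (moduleRep G M) ⊤ n := by
  have htop : (MonoidHom.id G).range = ⊤ := MonoidHom.range_eq_top.2 Function.surjective_id
  rw [← htop]
  exact isZero_groupCoh_comp_iff (moduleRep G M) (MonoidHom.id G) Function.injective_id n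

/-- The `H`-conjugates of division by `|H|` sum to the identity. -/
theorem isFinitelyAcyclic_of_isOrderInverting (h : IsOrderInverting G M) :
    IsFinitelyAcyclic G M := by
  refine isFinitelyAcyclic_iff.2 fun H _ n => ?_
  have := Fintype.ofFinite H
  let e : M ≃+ M := AddEquiv.ofBijective (nsmulAddMonoidHom (Nat.card H)) (h H inferInstance)
  have he (m : M) : e m = Nat.card H • m := rfl
  refine ExactOn.of_sum_conj_eq _ H e.symm.toAddMonoidHom (fun m => e.injective ?_) n
  rw [map_sum]
  change ∑ k : H, e (moduleRep G M k (e.symm (moduleRep G M (k : G)⁻¹ m))) = _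
  have hk (k : H) : e (moduleRep G M k (e.symm (moduleRep G M (k : G)⁻¹ m))) = m := by
    rw [he, ← map_nsmul, ← he, e.apply_symm_apply, ← Module.End.mul_apply, ← map_mul,
      mul_inv_cancel, map_one, Module.End.one_apply]
  simp [hk, he]

end

/-- The projection of `ℤG` onto the span of a subset `T` of `G` that kills the other group
elements. -/
noncomputable def restrictSupport (T : Set G) : MonoidAlgebra ℤ G →ₗ[ℤ] MonoidAlgebra ℤ G := by
  classical
  exact (Finsupp.linearCombination ℤ fun g =>
    if g ∈ T then (MonoidAlgebra.single g 1 : MonoidAlgebra ℤ G) else 0) ∘ₗ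
      (MonoidAlgebra.coeffLinearEquiv ℤ).toLinearMap

open Classical in
lemma restrictSupport_single (T : Set G) (g : G) (a : ℤ) :
    restrictSupport T (MonoidAlgebra.single g a) =
      if g ∈ T then MonoidAlgebra.single g a else 0 := by
  simp only [restrictSupport, LinearMap.comp_apply]
  erw [Finsupp.linearCombination_single]
  split_ifs <;> simp

/-- The restriction of `ℤG ⊗ A` to a finite subgroup `H` is induced from the trivial group: for a
transversal `T` of the cosets `Hg`, the `H`-conjugates of the projection of `ℤG ⊗ A` onto
`ℤT ⊗ A` sum to the identity. -/
theorem isFinitelyAcyclic_induced (A : Type w) [AddCommGroup A] :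
    IsFinitelyAcyclic G (MonoidAlgebra ℤ G ⊗[ℤ] A) := by
  classical
  refine isFinitelyAcyclic_iff.2 fun H _ n => ?_
  have := Fintype.ofFinite H
  obtain ⟨T, hT, -⟩ := H.exists_isComplement_right 1
  rw [Subgroup.isComplement_iff_existsUnique] at hT
  refine ExactOn.of_sum_conj_eq _ H ((restrictSupport T).rTensor A).toAddMonoidHom (fun m => ?_) n
  change ∑ h : H, moduleRep G _ h ((restrictSupport T).rTensor A (moduleRep G _ (h : G)⁻¹ m)) = m
  have hsmul (g : G) (x : MonoidAlgebra ℤ G) (a : A) :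
      moduleRep G (MonoidAlgebra ℤ G ⊗[ℤ] A) g (x ⊗ₜ a) = (MonoidAlgebra.single g 1 * x) ⊗ₜ a := rfl
  induction m using TensorProduct.induction_on with
  | zero => simp
  | add x y hx hy => simp only [map_add, Finset.sum_add_distrib, hx, hy]
  | tmul x a =>
    simp only [hsmul, LinearMap.rTensor_tmul, ← TensorProduct.sum_tmul]
    congr 1
    induction x using MonoidAlgebra.induction_linear with
    | zero => simp
    | add x y hx hy => simp only [mul_add, map_add, Finset.sum_add_distrib, hx, hy]
    | single g z =>
      obtain ⟨⟨⟨h₀, hh₀⟩, t⟩, ht, huniq⟩ := hT g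
      simp only [MonoidAlgebra.single_mul_single, one_mul, restrictSupport_single, mul_ite,
        mul_inv_cancel_left, mul_zero]
      -- Exactly one `h` in `H` moves `g` into the transversal.
      refine (Finset.sum_eq_single (⟨h₀, hh₀⟩ : H) (fun h _ hne => if_neg fun hmem => hne ?_)
        fun h => absurd (Finset.mem_univ _) h).trans (if_pos ?_)
      · exact congrArg Prod.fst (huniq (h, ⟨_, hmem⟩) (mul_inv_cancel_left _ _))
      · rw [← ht, inv_mul_cancel_left]
        exact t.2

end Modules

end HoltVanishing

theorem theorem3p10 (G : Type u) [Group G] (hG : HoltVanishing.IsLocallyFiniteGroup G) :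
    -- the main assertion
    (∀ (M : Type v) [AddCommGroup M] [Module (MonoidAlgebra ℤ G) M],
      HoltVanishing.IsFinitelyAcyclic G M →
        ∀ n : ℕ, HoltVanishing.alephRankAddOne G < (n : Ordinal.{u}) →
          Limits.IsZero (HoltVanishing.moduleCoh G M n)) ∧
    -- the induced module `AG = ℤG ⊗ A` is an example
    (∀ (A : Type w) [AddCommGroup A],
      HoltVanishing.IsFinitelyAcyclic G (MonoidAlgebra ℤ G ⊗[ℤ] A)) ∧
    -- every `o(G)`-inverting module is an example
    (∀ (M : Type v) [AddCommGroup M] [Module (MonoidAlgebra ℤ G) M],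
      HoltVanishing.IsOrderInverting G M → HoltVanishing.IsFinitelyAcyclic G M) := by
  refine ⟨fun M _ _ hM n hn => ?_, fun A _ => HoltVanishing.isFinitelyAcyclic_induced A,
    fun M _ _ h => HoltVanishing.isFinitelyAcyclic_of_isOrderInverting h⟩
  obtain ⟨n, rfl⟩ : ∃ m, n = m + 1 :=
    Nat.exists_eq_succ_of_ne_zero fun h => by simp [h] at hn
  exact (HoltVanishing.isZero_moduleCoh_succ_iff n).2
    (HoltVanishing.ExactOn.top_of_alephRankAddOne_lt hG _
      (HoltVanishing.isFinitelyAcyclic_iff.1 hM) n hn)
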